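/- Let $d\in\mathbb N_0$, let $X\subseteq\mathbb R^d$ be open, let $\psi:X\to X$ be smooth and injective with $\det J\psi(x)\neq 0$ for all $x\in X$, where $J\psi$ denotes the Jacobian matrix, and let $w\in C^\infty(X)$ be a complex-valued smooth function such that $\{x\in X:\ w(x)\neq 0\}$ is dense in $X$. Let $\mathscr D(X)$ be the space of complex-valued compactly supported smooth functions on $X$ with its standard (LF) locally convex topology, and let $\mathscr D'(X)$ be its dual, equipped with the strong topology of uniform convergence on the bounded subsets of $\mathscr D(X)$. Regard $C(X)$ as a subspace of $\mathscr D'(X)$ through $\langle f,\varphi\rangle=\int_X f\varphi\,dx$. There is exactly one continuous linear operator $C_{w,\psi}$ on $\mathscr D'(X)$ with $C_{w,\psi}(f)=w\cdot(f\circ\psi)$ for all $f\in C(X)$ (the weighted composition operator with weight $w$ and symbol $\psi$), and the following are equivalent. (i) $C_{w,\psi}$ is topologizable on $\mathscr D'(X)$, that is: for every continuous seminorm $p$ on $\mathscr D'(X)$ there is a continuous seminorm $q$ on $\mathscr D'(X)$ such that for every $m\in\mathbb N$ there is $\gamma_m>0$ with $p(C_{w,\psi}^m(u))\le\gamma_m\,q(u)$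 for all $u\in\mathscr D'(X)$. (ii) $\psi$ has stable orbits, that is: for every compact $K\subseteq X$ there is a compact $L\subseteq X$ such that $\psi^m(K)\subseteq L$ for every $m\in\mathbb N$. -/

import Mathlib

open scoped Distributions ContDiff

noncomputable section

/-- `ℝ^d` with its Euclidean norm. -/
abbrev RSpace (d : ℕ) : Type := EuclideanSpace ℝ (Fin d)

/-- The space `𝒟'(X)` of (complex) distributions on the open set `X`: the continuous `ℂ`-linear
forms on the LF-space `𝒟(X)` of complex-valued test functions. It carries the strong dual
topology, i.e. that of uniform convergence on the bounded subsets of `𝒟(X)`. -/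
abbrev DistSpace {d : ℕ} (X : TopologicalSpace.Opens (RSpace d)) : Type :=
  StrongDual ℂ 𝓓(X, ℂ)

/-- The distribution `φ ↦ ∫ φ(x) f(x) dx` on `X` defined by a function `f`
locally integrable on `X` (only the values of `f` on `X` matter). -/
def regularDist {d : ℕ} (X : TopologicalSpace.Opens (RSpace d)) (f : RSpace d → ℂ) :
    DistSpace X :=
  TestFunction.integralAgainstBilinCLM (ContinuousLinearMap.mul ℂ ℂ) MeasureTheory.volume f

/-- `T` is a continuous linear operator on `𝒟'(X)` that extends the weighted composition operator
`f ↦ w · (f ∘ ψ)` on `C(X)`. -/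
def IsWeightedCompositionOperator {d : ℕ} (X : TopologicalSpace.Opens (RSpace d))
    (w : RSpace d → ℂ) (ψ : RSpace d → RSpace d) (T : DistSpace X →L[ℂ] DistSpace X) : Prop :=
  ∀ f : RSpace d → ℂ, ContinuousOn f X →
    T (regularDist X f) = regularDist X (fun x => w x * f (ψ x))

/-- A continuous linear operator `T` on a locally convex space `E` is topologizable if for each
continuous seminorm `p` there is a continuous seminorm `q` such that for all `m` there is
`γ > 0` with `p (T^m x) ≤ γ q x` for all `x`. -/
def IsTopologizable {E : Type*} [AddCommGroup E] [Module ℂ E] [TopologicalSpace E]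
    (T : E →L[ℂ] E) : Prop :=
  ∀ p : Seminorm ℂ E, Continuous p → ∃ q : Seminorm ℂ E, Continuous q ∧
    ∀ m : ℕ, ∃ γ : ℝ, 0 < γ ∧ ∀ x : E, p (T^[m] x) ≤ γ * q x

/-- A self-map `ψ` of a subset `X` of a topological space has stable orbits on `X` if for every
compact `K ⊆ X` there is a compact `L ⊆ X` containing `ψ^m(K)` for all `m`. -/
def HasStableOrbitsOn {E : Type*} [TopologicalSpace E] (X : Set E) (ψ : E → E) : Prop :=
  ∀ K : Set E, IsCompact K → K ⊆ X →
    ∃ L : Set E, IsCompact L ∧ L ⊆ X ∧ ∀ m : ℕ, ψ^[m] '' K ⊆ L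

end

open Set TopologicalSpace Topology Bornology MeasureTheory
open scoped Convolution

/-! ### Seminorms of the strong dual and bounded sets. -/

section StrongDual

variable {E : Type*} [AddCommGroup E] [Module ℂ E] [TopologicalSpace E]

/-! The operator is the transpose of a continuous map `S` on test functions. By change of variables,
`S φ` is `(w / |det Jψ|) φ` transported by `ψ⁻¹` to the open set `ψ(X)` and extended by zero
(`exists_predual_weightedComposition`). Uniqueness follows because continuous functions are strongly
dense in `𝒟'(X)` (`exists_regularDist_approx`), by a finite-rank approximation of the identity on
test functions.

For the equivalence, continuous seminorms on `𝒟'(X)` are governed by bounded sets of test functions,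
and such a set lives in one compact set (`exists_compacts_support_subset`).

If orbits are stable and `B` is bounded, all the bounded sets `S^m B` are supported in one compact
`L`. A diagonal choice of constants, as in any metrizable space, puts suitable multiples of all of
them in a single bounded set (`exists_isVonNBounded_absorbing`), which gives `q`.

Conversely, test topologizability with the seminorm `|u φ|`. The resulting `q` kills every Dirac
mass outside some compact `L`, whatever `γ_m` is, so every `S^m φ` is supported in `L`. Since `ψ` is
open and `w` is nonzero on a dense set, `S^m φ` cannot vanish on the `ψ^m`-image of a nonempty open
subset of `{φ ≠ 0}`; hence `ψ^m {φ ≠ 0} ⊆ L`. Finitely many such sets cover a given compact. -/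

theorem exists_norm_le_of_isVonNBounded {F : Type*} [NormedAddCommGroup F] [NormedSpace ℂ F]
    {B : Set E} (hB : IsVonNBounded ℂ B) (u : E →L[ℂ] F) :
    ∃ C : ℝ, 0 ≤ C ∧ ∀ φ ∈ B, ‖u φ‖ ≤ C := by
  obtain ⟨C, hC⟩ := ((NormedSpace.isVonNBounded_iff ℂ).1 (hB.image u)).exists_norm_le
  exact ⟨max C 0, le_max_right _ _,
    fun φ hφ => (hC _ (mem_image_of_mem _ hφ)).trans (le_max_left _ _)⟩

/-- A continuous seminorm on the strong dual is controlled by the values on a bounded set. -/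
theorem exists_isVonNBounded_seminorm_le {p : Seminorm ℂ (StrongDual ℂ E)} (hp : Continuous p) :
    ∃ B : Set E, IsVonNBounded ℂ B ∧ ∃ C : ℝ, 0 < C ∧
      ∀ (u : StrongDual ℂ E) (c : ℝ), 0 ≤ c → (∀ φ ∈ B, ‖u φ‖ ≤ c) → p u ≤ C * c := by
  have h1 : {u | p u < 1} ∈ 𝓝 (0 : StrongDual ℂ E) :=
    (isOpen_lt hp continuous_const).mem_nhds (by simp)
  obtain ⟨⟨B, r⟩, ⟨hB, hr⟩, hsub⟩ :=
    (ContinuousLinearMap.hasBasis_nhds_zero_of_basis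
      (Metric.nhds_basis_closedBall (x := (0 : ℂ)))).mem_iff.1 h1
  -- Rescale `u` by `r / (c + r ε)` to enter the basic neighbourhood; the extra `r ε` keeps the
  -- denominator positive when `c = 0`.
  refine ⟨B, hB, r⁻¹, inv_pos.2 hr, fun u c hc hu => le_of_forall_pos_le_add fun ε hε => ?_⟩
  have hd : 0 < c + r * ε := by have := mul_pos hr hε; linarith
  have key : p (((r / (c + r * ε) : ℝ) : ℂ) • u) < 1 := by
    refine hsub fun φ hφ => ?_
    rw [mem_closedBall_zero_iff, smul_apply, norm_smul, Complex.norm_real,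
      Real.norm_of_nonneg (div_pos hr hd).le, div_mul_eq_mul_div, div_le_iff₀ hd]
    have := hu φ hφ
    have := mul_pos hr hε
    exact mul_le_mul_of_nonneg_left (by linarith) (le_of_lt hr)
  rw [map_smul_eq_mul, Complex.norm_real, Real.norm_of_nonneg (div_pos hr hd).le,
    div_mul_eq_mul_div, div_lt_one hd] at key
  have hr' : r ≠ 0 := hr.ne'
  have : p u < r⁻¹ * (c + r * ε) := by rw [inv_mul_eq_div, lt_div_iff₀ hr]; linarith
  rw [mul_add, inv_mul_cancel_left₀ hr'] at this
  exact this.le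

/-- The supremum over a bounded set, as a seminorm on the strong dual. -/
noncomputable def supSeminormOn {B : Set E} (hB : IsVonNBounded ℂ B) :
    Seminorm ℂ (StrongDual ℂ E) :=
  have hbdd (u : StrongDual ℂ E) : BddAbove (range fun φ : B => ‖u φ‖) := by
    obtain ⟨C, -, hC⟩ := exists_norm_le_of_isVonNBounded hB u
    exact ⟨C, by rintro _ ⟨φ, rfl⟩; exact hC φ φ.2⟩
  Seminorm.of (fun u => ⨆ φ : B, ‖u φ‖)
    (fun u v => by
      refine Real.iSup_le (fun φ => ?_)
        (add_nonneg (Real.iSup_nonneg fun _ => norm_nonneg _)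
          (Real.iSup_nonneg fun _ => norm_nonneg _))
      exact (norm_add_le _ _).trans (add_le_add (le_ciSup (hbdd u) φ) (le_ciSup (hbdd v) φ)))
    (fun a u => by
      simp only [smul_apply, norm_smul]
      rw [Real.mul_iSup_of_nonneg (norm_nonneg a)])

theorem norm_apply_le_supSeminormOn {B : Set E} (hB : IsVonNBounded ℂ B) (u : StrongDual ℂ E)
    {φ : E} (hφ : φ ∈ B) : ‖u φ‖ ≤ supSeminormOn hB u := by
  obtain ⟨C, -, hC⟩ := exists_norm_le_of_isVonNBounded hB u
  exact le_ciSup (f := fun φ : B => ‖u φ‖) ⟨C, by rintro _ ⟨φ, rfl⟩; exact hC φ φ.2⟩ ⟨φ, hφ⟩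

theorem supSeminormOn_le {B : Set E} (hB : IsVonNBounded ℂ B) {u : StrongDual ℂ E} {c : ℝ}
    (hc : 0 ≤ c) (h : ∀ φ ∈ B, ‖u φ‖ ≤ c) : supSeminormOn hB u ≤ c :=
  Real.iSup_le (fun φ : B => h φ φ.2) hc

theorem continuous_supSeminormOn {B : Set E} (hB : IsVonNBounded ℂ B) :
    Continuous (supSeminormOn hB) := by
  refine Seminorm.continuous' (r := 1) ?_
  filter_upwards [ContinuousLinearMap.eventually_nhds_zero_mapsTo hB
    (Metric.closedBall_mem_nhds (0 : ℂ) one_pos)] with u hu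
  rw [Seminorm.mem_closedBall_zero]
  exact supSeminormOn_le hB zero_le_one fun φ hφ => mem_closedBall_zero_iff.1 (hu hφ)

end StrongDual

/-! ### Bounded sets of test functions have a common compact support. -/

namespace TestFunction

variable {E : Type*} [NormedAddCommGroup E] [NormedSpace ℝ E] {Ω : Opens E}

/-- A test function as an element of `𝓓_{K}`, for a compact set `K` containing its support. -/
noncomputable def toSupportedIn {K : Compacts E} (φ : 𝓓(Ω, ℂ)) (h : Function.support φ ⊆ K) :
    𝓓_{K}(E, ℂ) :=
  .of_support_subset φ.contDiff h

/-- The singleton is the image, under the continuous inclusion, of a singleton of `𝓓_{K}` with `K =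
tsupport φ`. -/
theorem isVonNBounded_singleton (φ : 𝓓(Ω, ℂ)) : IsVonNBounded ℂ ({φ} : Set 𝓓(Ω, ℂ)) := by
  let K : Compacts E := ⟨tsupport φ, φ.hasCompactSupport⟩
  have := (Bornology.isVonNBounded_singleton (𝕜 := ℂ)
    (φ.toSupportedIn (K := K) (subset_tsupport φ))).image (ofSupportedInCLM ℂ φ.tsupport_subset)
  rwa [image_singleton] at this

/-- Scaled evaluation at a sequence of points which eventually leaves every compact subset. -/
theorem exists_clm_eval_seq (x : ℕ → E) (c : ℕ → ℂ)
    (hx : ∀ K : Set E, IsCompact K → K ⊆ Ω → ∃ N, ∀ n ≥ N, x n ∉ K) :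
    ∃ Λ : 𝓓(Ω, ℂ) →L[ℂ] BoundedContinuousFunction ℕ ℂ, ∀ φ n, Λ φ n = c n * φ (x n) := by
  -- Only the finitely many `n < N` with `x n` possibly in `K` contribute, so on `𝓓_{K}` the map is
  -- bounded by the sup norm, however fast `c` grows.
  have hbd : ∀ K : Set E, IsCompact K → K ⊆ Ω → ∃ C : ℝ, 0 ≤ C ∧ ∀ φ : 𝓓(Ω, ℂ),
      Function.support φ ⊆ K → ∀ (M : ℝ), (∀ y, ‖φ y‖ ≤ M) → ∀ n, ‖c n * φ (x n)‖ ≤ C * M := by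
    intro K hK hKΩ
    obtain ⟨N, hN⟩ := hx K hK hKΩ
    refine ⟨∑ n ∈ Finset.range N, ‖c n‖, Finset.sum_nonneg fun _ _ => norm_nonneg _,
      fun φ hφ M hM n => ?_⟩
    have hM0 : 0 ≤ M := (norm_nonneg _).trans (hM 0)
    rcases lt_or_ge n N with h | h
    · rw [norm_mul]
      exact mul_le_mul (Finset.single_le_sum (f := fun n => ‖c n‖) (fun _ _ => norm_nonneg _)
        (Finset.mem_range.2 h)) (hM _) (norm_nonneg _) (Finset.sum_nonneg fun _ _ => norm_nonneg _)
    · have : φ (x n) = 0 := by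
        by_contra h0
        exact hN n h (hφ h0)
      rw [this, mul_zero, norm_zero]
      exact mul_nonneg (Finset.sum_nonneg fun _ _ => norm_nonneg _) hM0
  have hex : ∀ φ : 𝓓(Ω, ℂ), ∃ C, ∀ n, ‖c n * φ (x n)‖ ≤ C := fun φ => by
    obtain ⟨C, -, hC⟩ := hbd _ φ.hasCompactSupport φ.tsupport_subset
    obtain ⟨M, hM⟩ := φ.continuous.bounded_above_of_compact_support φ.hasCompactSupport
    exact ⟨_, hC φ (subset_tsupport _) M hM⟩
  choose C₀ hC₀ using hex
  let Λ₀ : 𝓓(Ω, ℂ) → BoundedContinuousFunction ℕ ℂ := fun φ =>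
    .ofNormedAddCommGroup (fun n => c n * φ (x n)) continuous_of_discreteTopology _ (hC₀ φ)
  refine ⟨TestFunction.mkCLM ℂ Λ₀ ?_ ?_ ?_, fun φ n => rfl⟩
  · intro f g; ext n; exact mul_add _ _ _
  · intro a f; ext n; exact mul_left_comm _ _ _
  · intro K hK
    obtain ⟨C, hC0, hC⟩ := hbd K K.isCompact hK
    exact (ContDiffMapSupportedIn.mkCLMtoNormedSpace ℂ (K := K) (n := ⊤) (F := ℂ)
      (Λ₀ ∘ ofSupportedIn hK)
      (fun f g => by ext n; exact mul_add _ _ _) (fun a f => by ext n; exact mul_left_comm _ _ _)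
      ⟨{0}, C, hC0, fun f => (BoundedContinuousFunction.norm_le
        (mul_nonneg hC0 (apply_nonneg _ _))).2 fun n => by
          rw [Finset.sup_singleton]
          exact hC (ofSupportedIn hK f) f.support_subset _
            (fun y => ContDiffMapSupportedIn.norm_apply_le_seminorm ℂ) n⟩).continuous

/-- A bounded set of test functions is supported in a single compact set. -/
theorem exists_compacts_support_subset [FiniteDimensional ℝ E] {B : Set 𝓓(Ω, ℂ)}
    (hB : IsVonNBounded ℂ B) :
    ∃ K : Compacts E, (K : Set E) ⊆ Ω ∧ ∀ φ ∈ B, Function.support φ ⊆ K := by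
  by_contra! hcon
  have : LocallyCompactSpace Ω := Ω.isOpen.locallyCompactSpace
  have : ProperSpace E := FiniteDimensional.proper_real E
  let Ks : CompactExhaustion Ω := default
  let K (n : ℕ) : Compacts E := ⟨(↑) '' Ks n, (Ks.isCompact n).image continuous_subtype_val⟩
  have hK (n : ℕ) : (K n : Set E) ⊆ Ω := by rintro _ ⟨y, -, rfl⟩; exact y.2
  have hpt : ∀ n, ∃ φ ∈ B, ∃ x, φ x ≠ 0 ∧ x ∉ (K n : Set E) := fun n => by
    obtain ⟨φ, hφ, h⟩ := hcon (K n) (hK n)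
    obtain ⟨x, hx, hx'⟩ := not_subset.1 h
    exact ⟨φ, hφ, x, hx, hx'⟩
  choose φ hφB x hφx hxK using hpt
  -- The weights make the `n`-th entry of `Λ (φ n)` equal to `n`, so `Λ` is unbounded on `B`.
  obtain ⟨Λ, hΛ⟩ := exists_clm_eval_seq (Ω := Ω) x (fun n => n * (φ n (x n))⁻¹) (by
    intro L hL hLΩ
    have hL' : IsCompact ((↑) ⁻¹' L : Set Ω) :=
      Topology.IsInducing.subtypeVal.isCompact_preimage' hL (by simpa using hLΩ)
    obtain ⟨N, hN⟩ := Ks.exists_superset_of_isCompact hL'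
    refine ⟨N, fun n hn hxn => hxK n ?_⟩
    exact ⟨⟨x n, hLΩ hxn⟩, Ks.subset hn (hN hxn), rfl⟩)
  obtain ⟨C, -, hC⟩ := exists_norm_le_of_isVonNBounded hB Λ
  obtain ⟨n, hn⟩ := exists_nat_gt C
  have h1 := ((Λ (φ n)).norm_coe_le_norm n).trans (hC _ (hφB n))
  rw [hΛ, mul_assoc, inv_mul_cancel₀ (hφx n), mul_one, Complex.norm_natCast] at h1
  exact absurd h1 (not_le.2 hn)

end TestFunction

/-- A finite continuous partition of unity on a compact set, subordinate to small balls. -/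
theorem exists_finite_partition_of_unity {E : Type} [NormedAddCommGroup E]
    {K : Set E} (hK : IsCompact K) {η : ℝ} (hη : 0 < η) :
    ∃ (ι : Type) (_ : Fintype ι) (x : ι → E) (g : ι → E → ℂ),
      (∀ j, x j ∈ K) ∧ (∀ j, Continuous (g j)) ∧
      (∀ j, Function.support (g j) ⊆ Metric.closedBall (x j) η) ∧
      (∀ y ∈ K, ∑ j, g j y = 1) ∧ ∀ y ∈ K, ∑ j, ‖g j y‖ = 1 := by
  obtain ⟨t, htK, ht⟩ := hK.elim_nhds_subcover (fun x => Metric.ball x η)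
    fun x _ => Metric.ball_mem_nhds x hη
  obtain ⟨f, hf⟩ := PartitionOfUnity.exists_isSubordinate_of_locallyFinite hK.isClosed
    (fun j : t => Metric.ball (j : E) η) (fun _ => Metric.isOpen_ball)
    (locallyFinite_of_finite _) (by simpa [iUnion_subtype] using ht)
  have hsum : ∀ y ∈ K, ∑ j, f j y = 1 := fun y hy => by
    rw [← finsum_eq_sum_of_fintype]; exact f.sum_eq_one hy
  refine ⟨t, inferInstance, (↑), fun j y => (f j y : ℂ), fun j => htK j j.2,
    fun j => Complex.continuous_ofReal.comp (f j).continuous, fun j y hy => ?_, fun y hy => ?_,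
    fun y hy => ?_⟩
  · refine Metric.ball_subset_closedBall (hf j (subset_tsupport _ ?_))
    intro h
    exact hy (by simp [h])
  · simp only [← Complex.ofReal_sum, hsum y hy, Complex.ofReal_one]
  · rw [← hsum y hy]
    exact Finset.sum_congr rfl fun j _ => by
      rw [Complex.norm_real, Real.norm_of_nonneg (f.nonneg j y)]

/-! ### Approximation of test functions by finite sums of translated mollifiers. -/

section Convolution

variable {E : Type} [NormedAddCommGroup E] [InnerProductSpace ℝ E] [FiniteDimensional ℝ E]
  [MeasurableSpace E] [BorelSpace E]

/-- The derivative falls on `b` and leaves a convolution of the same form, now with values in `E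
→L[ℝ] F`; this permits induction on the order of differentiation. -/
theorem fderiv_convolution_lsmul {F : Type} [NormedAddCommGroup F] [NormedSpace ℂ F]
    {a : E → ℂ} (ha : Continuous a) {b : E → F} (hb : ContDiff ℝ ∞ b)
    (hbc : HasCompactSupport b) (y : E) :
    HasFDerivAt (a ⋆[ContinuousLinearMap.lsmul ℝ ℂ, volume] b : E → F)
      ((a ⋆[ContinuousLinearMap.lsmul ℝ ℂ, volume] fderiv ℝ b : E → E →L[ℝ] F) y) y := by
  have h := hbc.hasFDerivAt_convolution_right (μ := volume) (ContinuousLinearMap.lsmul ℝ ℂ)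
    ha.locallyIntegrable (hb.of_le (by norm_cast)) y
  exact h

/-- Replacing the mass of `a`, which is concentrated near `x₀`, by a Dirac mass at `x₀` changes
the derivatives of a convolution by a controlled amount. -/
theorem norm_iteratedFDeriv_convolution_sub_le {a : E → ℂ} (ha : Continuous a) {x₀ : E} {η : ℝ}
    (hsupp : Function.support a ⊆ Metric.closedBall x₀ η) (i : ℕ) :
    ∀ {F : Type} [NormedAddCommGroup F] [NormedSpace ℂ F] [CompleteSpace F] {b : E → F}
      (_ : ContDiff ℝ ∞ b) (_ : HasCompactSupport b) {M : ℝ}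
      (_ : ∀ y, ‖iteratedFDeriv ℝ (i + 1) b y‖ ≤ M) (y : E),
      ‖iteratedFDeriv ℝ i (fun y => (a ⋆[ContinuousLinearMap.lsmul ℝ ℂ, volume] b : E → F) y
        - (∫ t, a t) • b (y - x₀)) y‖ ≤ η * (∫ t, ‖a t‖) * M := by
  have hac : HasCompactSupport a :=
    HasCompactSupport.intro (isCompact_closedBall x₀ η) fun x hx => by
      by_contra h; exact hx (hsupp h)
  have hai : Integrable a := ha.integrable_of_hasCompactSupport hac
  induction i with
  | zero =>
    intro F _ _ _ b hb hbc M hM y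
    rw [norm_iteratedFDeriv_zero]
    have hM0 : 0 ≤ M := (norm_nonneg _).trans (hM 0)
    have hM' : ∀ z, ‖fderiv ℝ b z‖ ≤ M := fun z => by
      have := hM z
      rwa [zero_add, norm_iteratedFDeriv_one] at this
    have hlip : ∀ p q, ‖b p - b q‖ ≤ M * ‖p - q‖ := fun p q =>
      (convex_univ).norm_image_sub_le_of_norm_fderiv_le
        (fun z _ => (hb.differentiable (by simp)).differentiableAt) (fun z _ => hM' z)
        (mem_univ q) (mem_univ p)
    have hint : Integrable fun t => a t • b (y - t) :=
      (ha.smul (hb.continuous.comp (continuous_const.sub continuous_id))).integrable_of_hasCompactSupport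
        hac.smul_right
    have heq : (a ⋆[ContinuousLinearMap.lsmul ℝ ℂ, volume] b : E → F) y - (∫ t, a t) • b (y - x₀)
        = ∫ t, a t • (b (y - t) - b (y - x₀)) := by
      simp_rw [smul_sub]
      rw [integral_sub hint (hai.smul_const _), integral_smul_const]
      rfl
    rw [heq]
    calc ‖∫ t, a t • (b (y - t) - b (y - x₀))‖ ≤ ∫ t, ‖a t‖ * (M * η) := by
          refine norm_integral_le_of_norm_le (hai.norm.mul_const _) (.of_forall fun t => ?_)
          rw [norm_smul]
          by_cases ht : a t = 0
          · simp [ht]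
          · have h1 : ‖t - x₀‖ ≤ η := by
              simpa [dist_eq_norm] using hsupp ht
            refine mul_le_mul_of_nonneg_left ((hlip _ _).trans ?_) (norm_nonneg _)
            refine mul_le_mul_of_nonneg_left ?_ hM0
            rwa [sub_sub_sub_cancel_left, norm_sub_rev]
      _ = η * (∫ t, ‖a t‖) * M := by rw [integral_mul_const]; ring
  | succ i ih =>
    intro F _ _ _ b hb hbc M hM y
    -- Differentiating replaces `b` by `fderiv ℝ b`, which is why the target space `F` varies in the
    -- induction.
    have hfd : fderiv ℝ (fun y => (a ⋆[ContinuousLinearMap.lsmul ℝ ℂ, volume] b : E → F) y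
        - (∫ t, a t) • b (y - x₀)) =
        fun y => (a ⋆[ContinuousLinearMap.lsmul ℝ ℂ, volume] fderiv ℝ b : E → E →L[ℝ] F) y
        - (∫ t, a t) • fderiv ℝ b (y - x₀) := by
      ext1 y
      refine HasFDerivAt.fderiv ((fderiv_convolution_lsmul ha hb hbc y).sub ?_)
      have h := (hb.differentiable (by simp)).differentiableAt (x := y - x₀) |>.hasFDerivAt
      exact ((hasFDerivAt_comp_sub x₀).2 h).const_smul _
    rw [← norm_iteratedFDeriv_fderiv, hfd]
    exact ih (hb.fderiv_right (by simp)) (hbc.fderiv ℝ)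
      (fun z => by rw [norm_iteratedFDeriv_fderiv]; exact hM z) y

/-- A smooth mollifier with support in a small ball. -/
theorem exists_mollifier {δ : ℝ} (hδ : 0 < δ) :
    ∃ ρ : E → ℂ, ContDiff ℝ ∞ ρ ∧ Function.support ρ ⊆ Metric.closedBall 0 δ ∧
      ∫ t, ρ t = 1 ∧ ∫ t, ‖ρ t‖ = 1 := by
  let f : ContDiffBump (0 : E) := ⟨δ / 2, δ, half_pos hδ, half_lt_self hδ⟩
  refine ⟨fun t => (f.normed volume t : ℂ),
    Complex.ofRealCLM.contDiff.comp f.contDiff_normed, fun t ht => ?_, ?_, ?_⟩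
  · have : t ∈ Function.support (f.normed volume) := fun h => ht (by simp [h])
    rw [f.support_normed_eq] at this
    exact Metric.ball_subset_closedBall this
  · rw [integral_complex_ofReal, f.integral_normed, Complex.ofReal_one]
  · rw [← f.integral_normed (μ := volume)]
    exact integral_congr_ae (.of_forall fun t => by
      simp only [Complex.norm_real, Real.norm_of_nonneg (f.nonneg_normed t)])

/-- Derivative estimate for the approximation of a test function by the finite-rank operator
`φ ↦ ∑ j, (∫ g j * φ) ρ(· - x j)`. -/
theorem norm_iteratedFDeriv_sub_finite_rank_le {K : Set E} {φ ρ : E → ℂ}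
    (hφ : ContDiff ℝ ∞ φ) (hφc : HasCompactSupport φ) (hφK : Function.support φ ⊆ K)
    (hρ : ContDiff ℝ ∞ ρ) {δ : ℝ}
    (hρs : Function.support ρ ⊆ Metric.closedBall 0 δ) (hρ1 : ∫ t, ρ t = 1)
    (hρn : ∫ t, ‖ρ t‖ = 1) {ι : Type} [Fintype ι] {x : ι → E} {g : ι → E → ℂ}
    (hg : ∀ j, Continuous (g j)) {η : ℝ}
    (hgs : ∀ j, Function.support (g j) ⊆ Metric.closedBall (x j) η)
    (hg1 : ∀ y ∈ K, ∑ j, g j y = 1) (hgn : ∀ y ∈ K, ∑ j, ‖g j y‖ = 1) {i : ℕ} {M R : ℝ}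
    (hM : ∀ y, ‖iteratedFDeriv ℝ (i + 1) φ y‖ ≤ M)
    (hR : ∀ y, ‖iteratedFDeriv ℝ (i + 1) ρ y‖ ≤ R) (y : E) :
    ‖iteratedFDeriv ℝ i (fun y => φ y - ∑ j, (∫ t, φ t * g j t) * ρ (y - x j)) y‖ ≤
      δ * M + η * (∫ t, ‖φ t‖) * R := by
  have hρc : HasCompactSupport ρ :=
    HasCompactSupport.intro (isCompact_closedBall 0 δ) fun x hx => by
      by_contra h; exact hx (hρs h)
  have hφg (j : ι) : Continuous fun t => φ t * g j t := hφ.continuous.mul (hg j)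
  have hφgc (j : ι) : HasCompactSupport fun t => φ t * g j t := hφc.mul_right
  -- Two errors of the same kind. `P` replaces `ρ` by a Dirac mass at `0` (scale `δ`, derivatives of
  -- `φ`); `Q j` replaces `φ * g j` by a Dirac mass at `x j` (scale `η`, derivatives of `ρ`). The
  -- convolutions cancel because the `g j` sum to `1` on the support of `φ`.
  let P : E → ℂ := fun y => (ρ ⋆[ContinuousLinearMap.lsmul ℝ ℂ, volume] φ : E → ℂ) y
        - (∫ t, ρ t) • φ (y - 0)
  let Q : ι → E → ℂ := fun j y =>
    ((fun t => φ t * g j t) ⋆[ContinuousLinearMap.lsmul ℝ ℂ, volume] ρ : E → ℂ) y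
        - (∫ t, φ t * g j t) • ρ (y - x j)
  have hP : ContDiff ℝ ∞ P :=
    (hφc.contDiff_convolution_right _ hρ.continuous.locallyIntegrable hφ).sub
      ((hφ.comp (contDiff_id.sub contDiff_const)).const_smul (∫ t, ρ t))
  have hQ (j : ι) : ContDiff ℝ ∞ (Q j) :=
    (hρc.contDiff_convolution_right _ (hφg j).locallyIntegrable hρ).sub
      ((hρ.comp (contDiff_id.sub contDiff_const)).const_smul (∫ t, φ t * g j t))
  have heq : (fun y => φ y - ∑ j, (∫ t, φ t * g j t) * ρ (y - x j)) =
      (fun y => -P y + ∑ j, Q j y) := by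
    ext y
    have h1 : (ρ ⋆[ContinuousLinearMap.lsmul ℝ ℂ, volume] φ : E → ℂ) y =
        ∑ j, ((fun t => φ t * g j t) ⋆[ContinuousLinearMap.lsmul ℝ ℂ, volume] ρ : E → ℂ) y := by
      rw [← convolution_flip]
      simp only [convolution_def, ContinuousLinearMap.flip_apply, ContinuousLinearMap.lsmul_apply,
        smul_eq_mul]
      rw [← integral_finsetSum]
      · refine integral_congr_ae (.of_forall fun t => ?_)
        simp only
        rw [← Finset.sum_mul, ← Finset.mul_sum]
        by_cases ht : φ t = 0
        · simp [ht]
        · rw [hg1 t (hφK ht), mul_one, mul_comm]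
      · intro j _
        exact ((hφg j).mul (hρ.continuous.comp (continuous_const.sub continuous_id)))
          |>.integrable_of_hasCompactSupport (hφgc j).mul_right
    simp only [P, Q, Finset.sum_sub_distrib, ← h1, hρ1, sub_zero, smul_eq_mul]
    ring
  have hsumnorm : ∑ j, ∫ t, ‖φ t * g j t‖ = ∫ t, ‖φ t‖ := by
    rw [← integral_finsetSum]
    · refine integral_congr_ae (.of_forall fun t => ?_)
      simp only [norm_mul]
      rw [← Finset.mul_sum]
      by_cases ht : φ t = 0
      · simp [ht]
      · rw [hgn t (hφK ht), mul_one]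
    · intro j _
      exact ((hφg j).integrable_of_hasCompactSupport (hφgc j)).norm
  have hi : ((i : ℕ∞) : WithTop ℕ∞) ≤ ∞ := by exact_mod_cast le_top
  rw [heq]
  have hd : iteratedFDeriv ℝ i (fun y => -P y + ∑ j, Q j y) y =
      -iteratedFDeriv ℝ i P y + ∑ j, iteratedFDeriv ℝ i (Q j) y := by
    rw [← iteratedFDeriv_neg_apply,
      ← iteratedFDeriv_fun_sum_apply fun j _ => ((hQ j).of_le hi).contDiffAt]
    exact iteratedFDeriv_add_apply (hP.neg.of_le hi).contDiffAt
      ((ContDiff.sum fun j _ => hQ j).of_le hi).contDiffAt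
  rw [hd]
  refine (norm_add_le _ _).trans (add_le_add ?_ ?_)
  · rw [norm_neg]
    have := norm_iteratedFDeriv_convolution_sub_le hρ.continuous hρs i hφ hφc hM y
    rwa [hρn, mul_one] at this
  · rw [← hsumnorm, Finset.mul_sum, Finset.sum_mul]
    refine (norm_sum_le _ _).trans (Finset.sum_le_sum fun j _ => ?_)
    refine norm_iteratedFDeriv_convolution_sub_le (hφg j) (fun t ht => hgs j fun h => ?_) i
      hρ hρc hR y
    exact ht (by simp [h])

end Convolution

/-! ### Strong density of continuous functions in the distributions. -/

section Density

namespace TestFunction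

variable {E : Type*} [NormedAddCommGroup E] [NormedSpace ℝ E] {Ω : Opens E}

/-- Derivatives of a fixed order are uniformly bounded on a bounded set of test functions. -/
theorem exists_norm_iteratedFDeriv_le {E : Type} [NormedAddCommGroup E] [NormedSpace ℝ E]
    {Ω : Opens E} (i : ℕ) : ∀ {F : Type} [NormedAddCommGroup F] [NormedSpace ℂ F]
    {B : Set 𝓓(Ω, F)} (_ : IsVonNBounded ℂ B),
    ∃ C : ℝ, 0 ≤ C ∧ ∀ φ ∈ B, ∀ x, ‖iteratedFDeriv ℝ i φ x‖ ≤ C := by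
  induction i with
  | zero =>
    intro F _ _ B hB
    obtain ⟨C, hC0, hC⟩ := exists_norm_le_of_isVonNBounded hB (toBoundedContinuousFunctionCLM ℂ)
    refine ⟨C, hC0, fun φ hφ x => ?_⟩
    rw [norm_iteratedFDeriv_zero]
    exact (BoundedContinuousFunction.norm_coe_le_norm (φ : BoundedContinuousFunction E F) x).trans
      (hC φ hφ)
  | succ i ih =>
    intro F _ _ B hB
    obtain ⟨C, hC0, hC⟩ := ih (hB.image (fderivCLM ℂ ⊤ ⊤))
    refine ⟨C, hC0, fun φ hφ x => ?_⟩
    rw [← norm_iteratedFDeriv_fderiv, ← fderivCLM_apply_of_le (𝕜 := ℂ) (k := ⊤) φ le_top]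
    exact hC _ (mem_image_of_mem _ hφ) x

/-- On test functions supported in a fixed compact set, a distribution has finite order. -/
theorem exists_order_bound (u : StrongDual ℂ 𝓓(Ω, ℂ)) {K : Compacts E} (hK : (K : Set E) ⊆ Ω) :
    ∃ (s : Finset ℕ) (C : ℝ), 0 ≤ C ∧ ∀ (φ : 𝓓(Ω, ℂ)), Function.support φ ⊆ K →
      ∀ c : ℝ, 0 ≤ c → (∀ i ∈ s, ∀ y, ‖iteratedFDeriv ℝ i φ y‖ ≤ c) → ‖u φ‖ ≤ C * c := by
  obtain ⟨s, C, -, hC⟩ := Seminorm.bound_of_continuous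
    (ContDiffMapSupportedIn.withSeminorms ℂ E ℂ ⊤ K)
    ((normSeminorm ℂ ℂ).comp (u.comp (ofSupportedInCLM ℂ hK)).toLinearMap)
    (u.comp (ofSupportedInCLM ℂ hK)).continuous.norm
  refine ⟨s, C, C.2, fun φ hφ c hc h => ?_⟩
  refine (hC (φ.toSupportedIn hφ)).trans ?_
  refine mul_le_mul_of_nonneg_left ?_ C.2
  exact Seminorm.finset_sup_apply_le hc fun i hi =>
    (ContDiffMapSupportedIn.seminorm_top_le_iff ℂ hc i _).2 fun y _ => h i hi y

end TestFunction

theorem exists_pos_le_mul_le {δ₀ ε : ℝ} (hδ₀ : 0 < δ₀) (hε : 0 < ε) {A : ℝ} (hA : 0 ≤ A) :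
    ∃ δ, 0 < δ ∧ δ ≤ δ₀ ∧ δ * A ≤ ε := by
  refine ⟨min δ₀ (ε / (A + 1)), lt_min hδ₀ (by positivity), min_le_left _ _, ?_⟩
  calc min δ₀ (ε / (A + 1)) * A ≤ ε / (A + 1) * (A + 1) :=
        mul_le_mul (min_le_right _ _) (by linarith) hA (by positivity)
    _ = ε := div_mul_cancel₀ _ (by positivity)

theorem exists_forall_mem_le {b : ℕ → ℝ} (s : Finset ℕ) :
    ∃ M : ℝ, 0 ≤ M ∧ ∀ i ∈ s, b i ≤ M :=
  ⟨∑ i ∈ s, |b i|, Finset.sum_nonneg fun _ _ => abs_nonneg _, fun _ hi =>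
    (le_abs_self _).trans
      (Finset.single_le_sum (f := fun i => |b i|) (fun _ _ => abs_nonneg _) hi)⟩

variable {d : ℕ} {X : Opens (RSpace d)}

theorem regularDist_apply {f : RSpace d → ℂ} (hf : ContinuousOn f X) (φ : 𝓓(X, ℂ)) :
    regularDist X f φ = ∫ x, φ x * f x := by
  have h : LocallyIntegrableOn f X volume := hf.locallyIntegrableOn X.isOpen.measurableSet
  simp [regularDist, h]

/-- Distributions given by continuous functions are dense for uniform convergence on bounded
sets of test functions. -/
theorem exists_regularDist_approx (u : DistSpace X) {B : Set 𝓓(X, ℂ)} (hB : IsVonNBounded ℂ B)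
    {ε : ℝ} (hε : 0 < ε) :
    ∃ f : RSpace d → ℂ, Continuous f ∧ ∀ φ ∈ B, ‖u φ - regularDist X f φ‖ ≤ ε := by
  obtain ⟨K, hKX, hK⟩ := TestFunction.exists_compacts_support_subset hB
  obtain ⟨δ₀, hδ₀, hthick⟩ := K.isCompact.exists_cthickening_subset_open X.isOpen hKX
  -- The translates `ρ(· - x j)` leave `K` by at most `δ ≤ δ₀`, hence stay in `L`.
  let L : Compacts (RSpace d) := ⟨Metric.cthickening δ₀ K, K.isCompact.cthickening⟩
  obtain ⟨s, C, hC0, hC⟩ := TestFunction.exists_order_bound u (K := L) hthick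
  choose m hm0 hm using fun i => TestFunction.exists_norm_iteratedFDeriv_le i hB
  obtain ⟨M, hM0, hM⟩ := exists_forall_mem_le (b := fun i => m (i + 1)) s
  -- The order of choices matters: `δ` depends on the bounds for `B`, then `ρ` and its derivative
  -- bound `R` depend on `δ`, and only then is `η` chosen small against `R`.
  obtain ⟨δ, hδ, hδδ₀, hδM⟩ := exists_pos_le_mul_le hδ₀ (half_pos hε) (mul_nonneg hC0 hM0)
  obtain ⟨ρ, hρ, hρs, hρ1, hρn⟩ := exists_mollifier (E := RSpace d) hδ
  have hρc : HasCompactSupport ρ :=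
    HasCompactSupport.intro (isCompact_closedBall 0 δ) fun x hx => by
      by_contra h; exact hx (hρs h)
  have hρb : ∀ i : ℕ, ∃ r, ∀ y, ‖iteratedFDeriv ℝ (i + 1) ρ y‖ ≤ r := fun i =>
    (hρ.continuous_iteratedFDeriv (by exact_mod_cast le_top)).bounded_above_of_compact_support
      (hρc.iteratedFDeriv (i + 1))
  choose r hr using hρb
  obtain ⟨R, hR0, hR⟩ := exists_forall_mem_le (b := r) s
  have hA0 : 0 ≤ m 0 * volume.real (K : Set (RSpace d)) := mul_nonneg (hm0 0) measureReal_nonneg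
  have hA : ∀ φ ∈ B, ∫ t, ‖φ t‖ ≤ m 0 * volume.real (K : Set (RSpace d)) := fun φ hφ => by
    have h1 : ∫ t, ‖φ t‖ = ∫ t in (K : Set (RSpace d)), ‖φ t‖ := by
      rw [setIntegral_eq_integral_of_forall_compl_eq_zero]
      intro x hx
      rw [norm_eq_zero]
      by_contra h
      exact hx (hK φ hφ h)
    rw [h1]
    refine (Real.le_norm_self _).trans
      (norm_setIntegral_le_of_norm_le_const K.isCompact.measure_lt_top fun x _ => ?_)
    rw [norm_norm, ← norm_iteratedFDeriv_zero (𝕜 := ℝ)]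
    exact hm 0 φ hφ x
  obtain ⟨η, hη, -, hηA⟩ := exists_pos_le_mul_le one_pos (half_pos hε)
    (mul_nonneg hC0 (mul_nonneg hA0 hR0))
  obtain ⟨ι, _, x, g, hxK, hg, hgs, hg1, hgn⟩ := exists_finite_partition_of_unity K.isCompact hη
  have hcs (j : ι) : Function.support (fun y => ρ (y - x j)) ⊆ L := fun y hy => by
    have h1 : y - x j ∈ Metric.closedBall (0 : RSpace d) δ := hρs hy
    rw [mem_closedBall_zero_iff, ← dist_eq_norm] at h1
    exact Metric.mem_cthickening_of_dist_le _ _ _ _ (hxK j) (h1.trans hδδ₀)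
  let h (j : ι) : 𝓓(X, ℂ) := TestFunction.ofSupportedIn (K := L) hthick
    (.of_support_subset (hρ.comp (contDiff_id.sub contDiff_const)) (hcs j))
  have hh (j : ι) (y) : h j y = ρ (y - x j) := rfl
  -- This function is the image of `u` under the transpose of the finite-rank operator `φ ↦ ∑ j, (∫
  -- φ g j) h j`.
  have hfc : Continuous fun y => ∑ j, u (h j) * g j y :=
    continuous_finsetSum _ fun j _ => continuous_const.mul (hg j)
  refine ⟨_, hfc, fun φ hφ => ?_⟩
  have hval : regularDist X (fun y => ∑ j, u (h j) * g j y) φ =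
      u (∑ j, (∫ t, φ t * g j t) • h j) := by
    rw [regularDist_apply hfc.continuousOn, map_sum]
    simp_rw [map_smul, Finset.mul_sum, smul_eq_mul]
    rw [integral_finsetSum]
    · refine Finset.sum_congr rfl fun j _ => ?_
      rw [← integral_mul_const]
      exact integral_congr_ae (.of_forall fun t => by simp only; ring)
    · intro j _
      exact (φ.continuous.mul (continuous_const.mul (hg j))).integrable_of_hasCompactSupport
        φ.hasCompactSupport.mul_right
  rw [hval, ← map_sub]
  have hcoe : ⇑(φ - ∑ j, (∫ t, φ t * g j t) • h j) =
      fun y => φ y - ∑ j, (∫ t, φ t * g j t) * ρ (y - x j) := by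
    ext y
    rw [sub_apply, FunLike.coe_sum, Finset.sum_apply]
    rfl
  have hc0 : 0 ≤ δ * M + η * (m 0 * volume.real (K : Set (RSpace d))) * R := by positivity
  refine (hC _ ?_ _ hc0 ?_).trans ?_
  · rw [hcoe]
    intro y hy
    by_contra hyL
    refine hy ?_
    have h1 : φ y = 0 := by
      by_contra h1
      exact hyL (Metric.self_subset_cthickening _ (hK φ hφ h1))
    have h2 (j : ι) : ρ (y - x j) = 0 := by
      by_contra h2
      exact hyL (hcs j h2)
    simp [h1, h2]
  · intro i hi y
    rw [hcoe]
    refine (norm_iteratedFDeriv_sub_finite_rank_le φ.contDiff φ.hasCompactSupport (hK φ hφ) hρ hρs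
      hρ1 hρn hg hgs hg1 hgn (M := M) (R := R) (fun y => (hm _ φ hφ y).trans (hM i hi))
      (fun y => (hr i y).trans (hR i hi)) y).trans ?_
    gcongr
    exact hA φ hφ
  · nlinarith [hδM, hηA]

/-- Two continuous operators on `𝒟'(X)` which agree on continuous functions are equal. -/
theorem clm_ext_regularDist {T T' : DistSpace X →L[ℂ] DistSpace X}
    (h : ∀ f : RSpace d → ℂ, Continuous f → T (regularDist X f) = T' (regularDist X f)) :
    T = T' := by
  ext u φ
  have hφ := TestFunction.isVonNBounded_singleton φ
  let p : Seminorm ℂ (DistSpace X) := (supSeminormOn hφ).comp (T - T').toLinearMap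
  have hp : Continuous p := (continuous_supSeminormOn hφ).comp (T - T').continuous
  obtain ⟨B, hB, C, hC, hpB⟩ := exists_isVonNBounded_seminorm_le hp
  -- `p` is unchanged when a continuous function is subtracted from `u`, and the difference can be
  -- made small on `B`.
  have hpu : p u ≤ 0 := by
    refine le_of_forall_pos_le_add fun ε hε => ?_
    obtain ⟨f, hf, hfB⟩ := exists_regularDist_approx u hB (div_pos hε hC)
    have h1 : p u = p (u - regularDist X f) := by
      change supSeminormOn hφ ((T - T') u) = supSeminormOn hφ ((T - T') (u - regularDist X f))
      rw [map_sub, sub_apply T T' (regularDist X f), h f hf, sub_self, sub_zero]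
    rw [h1, zero_add]
    refine (hpB _ (ε / C) (div_pos hε hC).le fun φ hφ => hfB φ hφ).trans ?_
    rw [mul_div_cancel₀ _ hC.ne']
  have := (norm_apply_le_supSeminormOn hφ ((T - T') u) (mem_singleton φ)).trans hpu
  exact sub_eq_zero.1 (norm_le_zero_iff.1 this)

end Density

theorem natCast_le_infty (n : ℕ) : (n : WithTop ℕ∞) ≤ ∞ := by exact_mod_cast le_top

/-! ### The inverse function theorem and the smooth inverse of the symbol. -/

section Smooth

variable {E : Type*} [NormedAddCommGroup E] [NormedSpace ℝ E] [FiniteDimensional ℝ E]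

/-- By the Leibniz formula the determinant is a polynomial in the matrix entries. -/
theorem contDiff_continuousLinearMap_det {n : WithTop ℕ∞} :
    ContDiff ℝ n fun f : E →L[ℝ] E => f.det := by
  let b := Module.finBasis ℝ E
  have h : (fun f : E →L[ℝ] E => f.det) =
      fun f => ∑ σ : Equiv.Perm (Fin (Module.finrank ℝ E)),
        (Equiv.Perm.sign σ : ℤ) • ∏ i, (b.coord (σ i)).toContinuousLinearMap (f (b i)) := by
    ext f
    rw [ContinuousLinearMap.det, ← LinearMap.det_toMatrix b, Matrix.det_apply]
    simp [LinearMap.toMatrix_apply, Units.smul_def]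
  rw [h]
  refine ContDiff.sum fun σ _ => ContDiff.const_smul _ (contDiff_prod fun i _ => ?_)
  exact (ContinuousLinearMap.contDiff _).comp (contDiff_id.clm_apply contDiff_const)

variable {X : Set E} {ψ : E → E}

theorem isOpen_image_of_fderiv_det_ne_zero (hX : IsOpen X) (hψ : ContDiffOn ℝ ∞ ψ X)
    (hdet : ∀ x ∈ X, (fderiv ℝ ψ x).det ≠ 0) {U : Set E} (hU : IsOpen U) (hUX : U ⊆ X) :
    IsOpen (ψ '' U) := by
  have : CompleteSpace E := FiniteDimensional.complete ℝ E
  rw [isOpen_iff_mem_nhds]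
  rintro _ ⟨x, hx, rfl⟩
  have hs : HasStrictFDerivAt ψ
      ((fderiv ℝ ψ x).toContinuousLinearEquivOfDetNeZero (hdet x (hUX hx)) : E →L[ℝ] E) x :=
    ((hψ.contDiffAt (hX.mem_nhds (hUX hx))).hasStrictFDerivAt (by simp))
  rw [← hs.map_nhds_eq_of_equiv]
  exact Filter.image_mem_map (hU.mem_nhds hx)

/-- An injective, continuous, open map is a homeomorphism onto its image, and smoothness of the
inverse is then local, given by the inverse function theorem. -/
theorem contDiffOn_invFunOn (hX : IsOpen X) (hψ : ContDiffOn ℝ ∞ ψ X) (hinj : InjOn ψ X)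
    (hdet : ∀ x ∈ X, (fderiv ℝ ψ x).det ≠ 0) :
    ContDiffOn ℝ ∞ (Function.invFunOn ψ X) (ψ '' X) := by
  have : CompleteSpace E := FiniteDimensional.complete ℝ E
  let e : OpenPartialHomeomorph E E :=
    OpenPartialHomeomorph.ofContinuousOpenRestrict (InjOn.toPartialEquiv ψ X hinj)
      hψ.continuousOn (by
        intro V hV
        obtain ⟨U, hU, rfl⟩ := isOpen_induced_iff.1 hV
        have := isOpen_image_of_fderiv_det_ne_zero hX hψ hdet (hU.inter hX) inter_subset_right
        convert this using 1
        ext y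
        constructor
        · rintro ⟨⟨x, hx⟩, hxU, rfl⟩
          exact ⟨x, ⟨hxU, hx⟩, rfl⟩
        · rintro ⟨x, ⟨hxU, hx⟩, rfl⟩
          exact ⟨⟨x, hx⟩, hxU, rfl⟩) hX
  intro y hy
  have hgy : Function.invFunOn ψ X y ∈ X := Function.invFunOn_mem hy
  have hc := hψ.contDiffAt (hX.mem_nhds hgy)
  exact (e.contDiffAt_symm
    (f₀' := (fderiv ℝ ψ _).toContinuousLinearEquivOfDetNeZero (hdet _ hgy)) hy
    (hc.differentiableAt (by simp)).hasFDerivAt hc).contDiffWithinAt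

end Smooth

/-! ### Continuity of weighted pullbacks on test functions. -/

section Pullback

/-- The extension by zero of the weighted pullback `h · (φ ∘ g)` from an open set `Y`. -/
noncomputable def weightedPullback {E : Type*} (Y : Set E) (g : E → E) (h φ : E → ℂ) : E → ℂ :=
  Y.indicator fun y => h y * φ (g y)

theorem support_weightedPullback_subset {E : Type*} {Y : Set E} {g ψ : E → E} {h : E → ℂ}
    (hψg : ∀ y ∈ Y, ψ (g y) = y) {φ : E → ℂ} {K : Set E}
    (hφ : Function.support φ ⊆ K) : Function.support (weightedPullback Y g h φ) ⊆ ψ '' K := by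
  intro y hy
  have hyY : y ∈ Y := by
    by_contra hyY
    exact hy (indicator_of_notMem hyY _)
  refine ⟨g y, hφ fun h0 => hy ?_, hψg y hyY⟩
  rw [weightedPullback, indicator_of_mem hyY, h0, mul_zero]

variable {E : Type*} [NormedAddCommGroup E] [NormedSpace ℝ E]

/-- The normalization `1 ≤ C` gives `C ≤ C ^ l` for `l ≥ 1`, the form needed in the estimate for
derivatives of a composition. -/
theorem exists_bound_iteratedFDerivWithin {F : Type*} [NormedAddCommGroup F] [NormedSpace ℝ F]
    {f : E → F} {Y K : Set E} (hY : IsOpen Y) (hf : ContDiffOn ℝ ∞ f Y) (hK : IsCompact K)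
    (hKY : K ⊆ Y) (i : ℕ) :
    ∃ C : ℝ, 1 ≤ C ∧ ∀ l ≤ i, ∀ x ∈ K, ‖iteratedFDerivWithin ℝ l f Y x‖ ≤ C := by
  have h (l : ℕ) : ∃ C, ∀ x ∈ K, ‖iteratedFDerivWithin ℝ l f Y x‖ ≤ C :=
    hK.exists_bound_of_continuousOn ((hf.continuousOn_iteratedFDerivWithin
      (by exact_mod_cast le_top) hY.uniqueDiffOn).mono hKY)
  choose b hb using h
  obtain ⟨M, hM0, hM⟩ := exists_forall_mem_le (b := b) (Finset.range (i + 1))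
  refine ⟨M + 1, by linarith, fun l hl x hx => (hb l x hx).trans ?_⟩
  have := hM l (Finset.mem_range.2 (by omega))
  linarith

variable {X : Opens E} {Y : Set E} {g ψ : E → E} {h : E → ℂ}

/-- Extension by zero creates no singularity at the boundary of `Y`: the support lies in the compact
set `ψ '' K ⊆ Y`, whose complement is a neighbourhood of every point outside `Y`. -/
theorem contDiff_weightedPullback (hY : IsOpen Y) (hg : ContDiffOn ℝ ∞ g Y)
    (hh : ContDiffOn ℝ ∞ h Y) (hψg : ∀ y ∈ Y, ψ (g y) = y) (hψ : ContinuousOn ψ X)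
    (hψY : MapsTo ψ X Y) {φ : E → ℂ} {K : Set E} (hK : IsCompact K) (hKX : K ⊆ X)
    (hφ : ContDiff ℝ ∞ φ) (hφK : Function.support φ ⊆ K) :
    ContDiff ℝ ∞ (weightedPullback Y g h φ) := by
  rw [contDiff_iff_contDiffAt]
  intro y
  by_cases hy : y ∈ Y
  · have hYy := hY.mem_nhds hy
    refine ((hh.contDiffAt hYy).mul (hφ.contDiffAt.comp y (hg.contDiffAt hYy))).congr_of_eventuallyEq
      ?_
    filter_upwards [hYy] with z hz
    exact indicator_of_mem hz _
  · have hc : IsCompact (ψ '' K) := hK.image_of_continuousOn (hψ.mono hKX)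
    have hy' : y ∉ ψ '' K := fun ⟨x, hx, hxy⟩ => hy (hxy ▸ hψY (hKX hx))
    refine contDiffAt_const (c := (0 : ℂ)) |>.congr_of_eventuallyEq ?_
    filter_upwards [hc.isClosed.isOpen_compl.mem_nhds hy'] with z hz
    by_contra h0
    exact hz (support_weightedPullback_subset hψg hφK h0)

/-- Weighted pullback along a smooth right inverse of `ψ` acts continuously on test functions. -/
theorem exists_weightedPullbackCLM (hY : IsOpen Y) (hYX : Y ⊆ X) (hg : ContDiffOn ℝ ∞ g Y)
    (hh : ContDiffOn ℝ ∞ h Y) (hψg : ∀ y ∈ Y, ψ (g y) = y) (hψ : ContinuousOn ψ X)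
    (hψY : MapsTo ψ X Y) :
    ∃ S : 𝓓(X, ℂ) →L[ℂ] 𝓓(X, ℂ), ∀ φ, ⇑(S φ) = weightedPullback Y g h φ := by
  have himg {K : Set E} (hK : IsCompact K) (hKX : K ⊆ X) : IsCompact (ψ '' K) ∧ ψ '' K ⊆ Y :=
    ⟨hK.image_of_continuousOn (hψ.mono hKX), (hψY.mono_left hKX).image_subset⟩
  have hadd (f₁ f₂ : E → ℂ) (y : E) : weightedPullback Y g h (f₁ + f₂) y =
      weightedPullback Y g h f₁ y + weightedPullback Y g h f₂ y := by
    by_cases hy : y ∈ Y <;> simp [weightedPullback, hy, mul_add]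
  have hsmul (c : ℂ) (f : E → ℂ) (y : E) : weightedPullback Y g h (c • f) y =
      c • weightedPullback Y g h f y := by
    by_cases hy : y ∈ Y <;> simp [weightedPullback, hy, mul_left_comm]
  let S₀ : 𝓓(X, ℂ) → 𝓓(X, ℂ) := fun φ =>
    have hs := support_weightedPullback_subset (h := h) hψg (subset_tsupport φ)
    have hi := himg φ.hasCompactSupport φ.tsupport_subset
    ⟨weightedPullback Y g h φ,
      contDiff_weightedPullback hY hg hh hψg hψ hψY φ.hasCompactSupport φ.tsupport_subset
        φ.contDiff (subset_tsupport φ),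
      HasCompactSupport.of_support_subset_isCompact hi.1 hs,
      (closure_minimal hs hi.1.isClosed).trans (hi.2.trans hYX)⟩
  refine ⟨TestFunction.mkCLM ℂ S₀ (fun f₁ f₂ => TestFunction.ext fun y => hadd f₁ f₂ y)
    (fun c f => TestFunction.ext fun y => hsmul c f y) ?_, fun φ => rfl⟩
  intro K hKX
  obtain ⟨hK'c, hK'Y⟩ := himg K.isCompact hKX
  let K' : Compacts E := ⟨ψ '' K, hK'c⟩
  -- On a fixed `K`, the Leibniz rule and the bound for derivatives of a composition control order
  -- `i` by the seminorms of `φ` of order at most `i`, with constants from the compact set `ψ '' K`.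
  let A : 𝓓_{K}(E, ℂ) →L[ℂ] 𝓓_{K'}(E, ℂ) := ContDiffMapSupportedIn.mkCLM ℂ
    (fun φ => weightedPullback Y g h φ) (fun f₁ f₂ y => hadd f₁ f₂ y) (fun c f y => hsmul c f y)
    (fun φ => contDiff_weightedPullback hY hg hh hψg hψ hψY K.isCompact hKX φ.contDiff
      φ.support_subset)
    (fun φ y hy => by
      by_contra h0
      exact hy (support_weightedPullback_subset hψg φ.support_subset h0))
    (by
      intro i _
      obtain ⟨D, hD1, hD⟩ := exists_bound_iteratedFDerivWithin hY hg hK'c hK'Y i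
      obtain ⟨H, hH1, hH⟩ := exists_bound_iteratedFDerivWithin hY hh hK'c hK'Y i
      refine ⟨Finset.Iic i, ∑ j ∈ Finset.range (i + 1),
        (i.choose j : ℝ) * H * (((i - j).factorial : ℝ) * D ^ (i - j)), by positivity, fun φ y hy => ?_⟩
      have hyY := hK'Y hy
      set N := ((Finset.Iic i).sup fun j => ContDiffMapSupportedIn.seminorm ℂ E ℂ ⊤ K j) φ with hN
      have hgφ : ContDiffOn ℝ ∞ (φ ∘ g) Y := φ.contDiff.comp_contDiffOn hg
      have e1 : iteratedFDeriv ℝ i (weightedPullback Y g h φ) y =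
          iteratedFDerivWithin ℝ i (fun y => h y * (φ ∘ g) y) Y y := by
        rw [← iteratedFDerivWithin_of_isOpen i hY hyY]
        exact iteratedFDerivWithin_congr (fun z hz => indicator_of_mem hz _) hyY i
      rw [e1, Finset.sum_mul]
      refine (norm_iteratedFDerivWithin_mul_le hh hgφ hY.uniqueDiffOn hyY
        (by exact_mod_cast le_top)).trans (Finset.sum_le_sum fun j hj => ?_)
      have hji : j ≤ i := Nat.lt_succ_iff.1 (Finset.mem_range.1 hj)
      have e2 : ‖iteratedFDerivWithin ℝ (i - j) (φ ∘ g) Y y‖ ≤ (i - j).factorial * N * D ^ (i - j) := by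
        refine norm_iteratedFDerivWithin_comp_le (t := univ) (N := ∞) φ.contDiff.contDiffOn hg
          (natCast_le_infty _) uniqueDiffOn_univ hY.uniqueDiffOn (mapsTo_univ _ _) hyY
          (fun l hl => ?_) (fun l hl1 hl => ?_)
        · rw [iteratedFDerivWithin_univ]
          exact (ContDiffMapSupportedIn.norm_iteratedFDeriv_apply_le_seminorm_top ℂ).trans
            (Seminorm.le_finset_sup_apply (p := fun j => ContDiffMapSupportedIn.seminorm ℂ E ℂ ⊤ K j)
              (Finset.mem_Iic.2 (hl.trans (Nat.sub_le _ _))))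
        · exact (hD l (hl.trans (Nat.sub_le _ _)) y hy).trans
            (le_self_pow₀ hD1 (Nat.one_le_iff_ne_zero.1 hl1))
      have hN0 : 0 ≤ N := apply_nonneg _ _
      calc _ ≤ (i.choose j : ℝ) * H * (((i - j).factorial : ℝ) * N * D ^ (i - j)) := by
            gcongr
            exact hH j hji y hy
        _ = _ := by ring)
  exact ((TestFunction.ofSupportedInCLM ℂ (hK'Y.trans hYX)).comp A).continuous

end Pullback

/-! ### The predual operator, and topologizability against stable orbits. -/

section WeightedComposition

variable {d : ℕ} {X : Opens (RSpace d)} {w : RSpace d → ℂ} {ψ : RSpace d → RSpace d}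

/-- The predual of the weighted composition operator. -/
theorem exists_predual_weightedComposition (hw : ContDiffOn ℝ ∞ w X) (hψ_maps : MapsTo ψ X X)
    (hψ : ContDiffOn ℝ ∞ ψ X) (hψ_inj : InjOn ψ X)
    (hψ_det : ∀ x ∈ X, (fderiv ℝ ψ x).det ≠ 0) :
    ∃ S : 𝓓(X, ℂ) →L[ℂ] 𝓓(X, ℂ),
      (∀ φ, Function.support (S φ) ⊆ ψ '' Function.support φ) ∧
      (∀ φ, ∀ x ∈ X, w x ≠ 0 → φ x ≠ 0 → S φ (ψ x) ≠ 0) ∧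
      ∀ f : RSpace d → ℂ, ContinuousOn f X → ∀ φ,
        regularDist X f (S φ) = regularDist X (fun x => w x * f (ψ x)) φ := by
  let g := Function.invFunOn ψ X
  -- The Jacobian factor comes from the substitution `y = ψ x`; its absolute value is smooth because
  -- the determinant has no zeros on `X`.
  let J : RSpace d → ℂ := fun x => ((|(fderiv ℝ ψ x).det| : ℝ) : ℂ)
  let v : RSpace d → ℂ := fun x => w x * (J x)⁻¹
  have hJ0 : ∀ x ∈ X, J x ≠ 0 := fun x hx => by simpa [J] using hψ_det x hx
  have hgψ : ∀ x ∈ X, g (ψ x) = x := fun x hx => hψ_inj.leftInvOn_invFunOn hx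
  have hψg : ∀ y ∈ ψ '' X, ψ (g y) = y := fun y hy => Function.invFunOn_eq hy
  have hgX : MapsTo g (ψ '' X) X := fun y hy => Function.invFunOn_mem hy
  have hY : IsOpen (ψ '' (X : Set (RSpace d))) :=
    isOpen_image_of_fderiv_det_ne_zero X.isOpen hψ hψ_det X.isOpen subset_rfl
  have hg : ContDiffOn ℝ ∞ g (ψ '' X) := contDiffOn_invFunOn X.isOpen hψ hψ_inj hψ_det
  have hv : ContDiffOn ℝ ∞ v X := by
    have h1 : ContDiffOn ℝ ∞ (fun x => |(fderiv ℝ ψ x).det|) X :=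
      (contDiff_continuousLinearMap_det.comp_contDiffOn
        (hψ.fderiv_of_isOpen X.isOpen (by simp))).abs hψ_det
    exact hw.mul ((Complex.ofRealCLM.contDiff.comp_contDiffOn h1).inv hJ0)
  obtain ⟨S, hS⟩ := exists_weightedPullbackCLM (X := X) hY hψ_maps.image_subset hg
    (hv.comp hg hgX) hψg hψ.continuousOn (mapsTo_image ψ X)
  have hSψ : ∀ φ, ∀ x ∈ X, S φ (ψ x) = w x * (J x)⁻¹ * φ x := fun φ x hx => by
    rw [hS, weightedPullback, indicator_of_mem (mem_image_of_mem ψ hx)]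
    simp only [Function.comp_apply, hgψ x hx, v]
  have hsupp : ∀ φ, Function.support (S φ) ⊆ ψ '' Function.support φ := fun φ => by
    rw [hS]; exact support_weightedPullback_subset hψg subset_rfl
  have hsuppX : ∀ φ : 𝓓(X, ℂ), Function.support φ ⊆ X := fun φ =>
    (subset_tsupport φ).trans φ.tsupport_subset
  refine ⟨S, hsupp, fun φ x hx hwx hφx => ?_, fun f hf φ => ?_⟩
  · rw [hSψ φ x hx]
    exact mul_ne_zero (mul_ne_zero hwx (inv_ne_zero (hJ0 x hx))) hφx
  · have hwf : ContinuousOn (fun x => w x * f (ψ x)) X :=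
      hw.continuousOn.mul (hf.comp hψ.continuousOn hψ_maps)
    rw [regularDist_apply hf, regularDist_apply hwf]
    have e1 : ∫ y, S φ y * f y = ∫ y in ψ '' X, S φ y * f y := by
      rw [setIntegral_eq_integral_of_forall_compl_eq_zero]
      intro y hy
      have : S φ y = 0 := by
        by_contra h0
        exact hy (image_mono (hsuppX φ) (hsupp φ h0))
      rw [this, zero_mul]
    have e2 : ∫ x, φ x * (w x * f (ψ x)) = ∫ x in X, φ x * (w x * f (ψ x)) := by
      rw [setIntegral_eq_integral_of_forall_compl_eq_zero]
      intro x hx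
      have : φ x = 0 := by
        by_contra h0
        exact hx (hsuppX φ h0)
      rw [this, zero_mul]
    rw [e1, e2, integral_image_eq_integral_abs_det_fderiv_smul volume X.isOpen.measurableSet
      (fun x hx => ((hψ.contDiffAt (X.isOpen.mem_nhds hx)).differentiableAt
        (by simp)).hasFDerivAt.hasFDerivWithinAt) hψ_inj]
    refine setIntegral_congr_fun X.isOpen.measurableSet fun x hx => ?_
    rw [hSψ φ x hx, Complex.real_smul]
    change J x * _ = _
    have := hJ0 x hx
    field_simp

/-- Countably many bounded sets of test functions supported in a common compact set can be
absorbed by a single bounded set. -/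
theorem exists_isVonNBounded_absorbing {Bs : ℕ → Set 𝓓(X, ℂ)}
    (hBs : ∀ m, IsVonNBounded ℂ (Bs m)) {L : Compacts (RSpace d)} (hLX : (L : Set (RSpace d)) ⊆ X)
    (hL : ∀ m, ∀ φ ∈ Bs m, Function.support φ ⊆ L) :
    ∃ (B : Set 𝓓(X, ℂ)) (γ : ℕ → ℝ), IsVonNBounded ℂ B ∧ (∀ m, 0 < γ m) ∧
      ∀ m, ∀ φ ∈ Bs m, (((γ m)⁻¹ : ℝ) : ℂ) • φ ∈ B := by
  choose b hb0 hb using fun m i => TestFunction.exists_norm_iteratedFDeriv_le i (hBs m)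
  -- Diagonal choice: `γ m` dominates the bounds of all orders `i ≤ m`, so for a fixed order `i`
  -- only the finitely many `m < i` escape.
  let γ (m : ℕ) : ℝ := 1 + ∑ i ∈ Finset.range (m + 1), b m i
  have hγ1 (m : ℕ) : 1 ≤ γ m :=
    le_add_of_nonneg_right (Finset.sum_nonneg fun i _ => hb0 m i)
  let c (m : ℕ) : ℂ := (((γ m)⁻¹ : ℝ) : ℂ)
  have hc (m : ℕ) : ‖c m‖ = (γ m)⁻¹ := by
    rw [Complex.norm_real, Real.norm_of_nonneg (inv_nonneg.2 (zero_le_one.trans (hγ1 m)))]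
  let A : Set 𝓓_{L}(RSpace d, ℂ) :=
    {f | ∃ m, ∃ φ, ∃ h : φ ∈ Bs m, f = c m • φ.toSupportedIn (hL m φ h)}
  have hA : IsVonNBounded ℂ A := by
    rw [(ContDiffMapSupportedIn.withSeminorms ℂ (RSpace d) ℂ ⊤
      L).isVonNBounded_iff_seminorm_bounded]
    intro i
    have hpos : 0 ≤ ∑ m ∈ Finset.range i, b m i := Finset.sum_nonneg fun m _ => hb0 m i
    refine ⟨2 + ∑ m ∈ Finset.range i, b m i, by linarith, ?_⟩
    rintro _ ⟨m, φ, hφ, rfl⟩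
    have h1 : ContDiffMapSupportedIn.seminorm ℂ (RSpace d) ℂ ⊤ L i
        (φ.toSupportedIn (hL m φ hφ)) ≤ b m i :=
      (ContDiffMapSupportedIn.seminorm_top_le_iff ℂ (hb0 m i) i _).2 fun y _ => hb m i φ hφ y
    have hγ0 : 0 < γ m := zero_lt_one.trans_le (hγ1 m)
    rw [map_smul_eq_mul, hc]
    refine (mul_le_mul_of_nonneg_left h1 (inv_nonneg.2 hγ0.le)).trans_lt ?_
    rw [inv_mul_eq_div, div_lt_iff₀ hγ0]
    rcases lt_or_ge m i with hmi | hmi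
    · have h2 : b m i ≤ ∑ m ∈ Finset.range i, b m i :=
        Finset.single_le_sum (f := fun m => b m i) (fun m _ => hb0 m i) (Finset.mem_range.2 hmi)
      nlinarith [hγ1 m]
    · have h2 : b m i ≤ ∑ i ∈ Finset.range (m + 1), b m i :=
        Finset.single_le_sum (fun i _ => hb0 m i) (Finset.mem_range.2 (by omega))
      have h3 : b m i + 1 ≤ γ m := by simp only [γ]; linarith
      nlinarith [hγ1 m]
  refine ⟨_, γ, hA.image (TestFunction.ofSupportedInCLM ℂ hLX),
    fun m => zero_lt_one.trans_le (hγ1 m), fun m φ hφ => ?_⟩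
  exact ⟨_, ⟨m, φ, hφ, rfl⟩, rfl⟩

variable {S : 𝓓(X, ℂ) →L[ℂ] 𝓓(X, ℂ)} {T : DistSpace X →L[ℂ] DistSpace X}

theorem iterate_dual_apply (hT : ∀ u φ, T u φ = u (S φ)) (m : ℕ) (u : DistSpace X) (φ : 𝓓(X, ℂ)) :
    T^[m] u φ = u (S^[m] φ) := by
  induction m generalizing φ with
  | zero => rfl
  | succ m ih => rw [Function.iterate_succ_apply', hT, ih, Function.iterate_succ_apply]

theorem support_iterate_subset (hS : ∀ φ, Function.support (S φ) ⊆ ψ '' Function.support φ)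
    (m : ℕ) (φ : 𝓓(X, ℂ)) : Function.support (S^[m] φ) ⊆ ψ^[m] '' Function.support φ := by
  induction m with
  | zero => simp
  | succ m ih =>
    rw [Function.iterate_succ_apply', Function.iterate_succ', image_comp]
    exact (hS _).trans (image_mono ih)

theorem isTopologizable_of_hasStableOrbitsOn
    (hS : ∀ φ, Function.support (S φ) ⊆ ψ '' Function.support φ)
    (hT : ∀ u φ, T u φ = u (S φ)) (hψ : HasStableOrbitsOn (X : Set (RSpace d)) ψ) :
    IsTopologizable T := by
  intro p hp
  obtain ⟨B, hB, C, hC, hpB⟩ := exists_isVonNBounded_seminorm_le hp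
  obtain ⟨K, hKX, hK⟩ := TestFunction.exists_compacts_support_subset hB
  obtain ⟨L, hLc, hLX, hL⟩ := hψ K K.isCompact hKX
  have hBm (m : ℕ) : IsVonNBounded ℂ (S^[m] '' B) := by
    induction m with
    | zero => simpa using hB
    | succ m ih => rw [Function.iterate_succ', image_comp]; exact ih.image S
  obtain ⟨B', γ, hB', hγ, hBB'⟩ := exists_isVonNBounded_absorbing (L := ⟨L, hLc⟩) hBm hLX (by
    rintro m _ ⟨φ, hφ, rfl⟩
    exact (support_iterate_subset hS m φ).trans ((image_mono (hK φ hφ)).trans (hL m)))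
  refine ⟨supSeminormOn hB', continuous_supSeminormOn hB', fun m =>
    ⟨C * γ m, mul_pos hC (hγ m), fun u => ?_⟩⟩
  rw [mul_assoc]
  refine hpB _ _ (mul_nonneg (hγ m).le (apply_nonneg _ _)) fun φ hφ => ?_
  have h1 := norm_apply_le_supSeminormOn hB' u (hBB' m _ (mem_image_of_mem _ hφ))
  rw [map_smul, norm_smul, Complex.norm_real, Real.norm_of_nonneg (inv_nonneg.2 (hγ m).le),
    inv_mul_eq_div, div_le_iff₀ (hγ m)] at h1
  rw [iterate_dual_apply hT, mul_comm]
  exact h1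

/-- Iterates of the predual do not vanish identically along the image of an open set on which
the test function has no zeros. -/
theorem exists_iterate_apply_ne_zero (hw : ContinuousOn w X)
    (hw_dense : (X : Set (RSpace d)) ⊆ closure {x | x ∈ X ∧ w x ≠ 0})
    (hψ_open : ∀ U : Set (RSpace d), IsOpen U → U ⊆ X → IsOpen (ψ '' U))
    (hψ_maps : MapsTo ψ X X)
    (hS : ∀ φ, ∀ x ∈ X, w x ≠ 0 → φ x ≠ 0 → S φ (ψ x) ≠ 0) (m : ℕ) :
    ∀ (φ : 𝓓(X, ℂ)) (U : Set (RSpace d)), IsOpen U → U ⊆ X → U.Nonempty →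
      (∀ x ∈ U, φ x ≠ 0) → ∃ x ∈ U, S^[m] φ (ψ^[m] x) ≠ 0 := by
  induction m with
  | zero => rintro φ U - - ⟨x, hx⟩ h; exact ⟨x, hx, h x hx⟩
  | succ m ih =>
    rintro φ U hU hUX ⟨x, hx⟩ h
    -- Removing the zeros of `w` leaves an open set, nonempty by density. Its image under `ψ` is
    -- open and `S φ` has no zeros there, so the induction hypothesis applies to `S φ`.
    have hU' : IsOpen (U ∩ w ⁻¹' {0}ᶜ) :=
      (hw.mono hUX).isOpen_inter_preimage hU isOpen_compl_singleton
    obtain ⟨y, hyU, -, hyw⟩ := mem_closure_iff.1 (hw_dense (hUX hx)) U hU hx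
    obtain ⟨_, ⟨z, ⟨hzU, -⟩, rfl⟩, hz'⟩ := ih (S φ) (ψ '' (U ∩ w ⁻¹' {0}ᶜ))
      (hψ_open _ hU' (inter_subset_left.trans hUX))
      ((hψ_maps.mono_left (inter_subset_left.trans hUX)).image_subset)
      ⟨_, mem_image_of_mem _ ⟨hyU, hyw⟩⟩ (by
        rintro _ ⟨z, ⟨hzU, hzw⟩, rfl⟩
        exact hS φ z (hUX hzU) hzw (h z hzU))
    exact ⟨z, hzU, hz'⟩

/-- The Dirac distribution at a point. -/
noncomputable def diracDist (X : Opens (RSpace d)) (y : RSpace d) : DistSpace X where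
  toFun φ := φ y
  map_add' _ _ := rfl
  map_smul' _ _ := rfl
  cont := continuous_eval_const y

/-- Dirac masses off the common support of the bounded set controlling `q` are annihilated by `q`,
hence by `u ↦ |(T^m u) φ|`, which at a Dirac mass is `|S^m φ (y)|`. -/
theorem exists_compact_support_iterate_subset (hT : ∀ u φ, T u φ = u (S φ))
    (htop : IsTopologizable T) (φ : 𝓓(X, ℂ)) :
    ∃ L : Set (RSpace d), IsCompact L ∧ L ⊆ X ∧ ∀ m, Function.support (S^[m] φ) ⊆ L := by
  have hφ := TestFunction.isVonNBounded_singleton φ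
  obtain ⟨q, hq, hpq⟩ := htop _ (continuous_supSeminormOn hφ)
  obtain ⟨B, hB, C, hC, hqB⟩ := exists_isVonNBounded_seminorm_le hq
  obtain ⟨L, hLX, hL⟩ := TestFunction.exists_compacts_support_subset hB
  refine ⟨L, L.isCompact, hLX, fun m y hy => ?_⟩
  by_contra hyL
  obtain ⟨γ, hγ, hm⟩ := hpq m
  have h0 : q (diracDist X y) ≤ C * 0 := hqB _ 0 le_rfl fun f hf => by
    have : f y = 0 := by
      by_contra h
      exact hyL (hL f hf h)
    exact (norm_eq_zero.2 this).le
  have h1 := (norm_apply_le_supSeminormOn hφ _ (mem_singleton φ)).trans (hm (diracDist X y))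
  rw [iterate_dual_apply hT] at h1
  have h2 : ‖S^[m] φ y‖ ≤ 0 := h1.trans (by nlinarith)
  exact hy (norm_le_zero_iff.1 h2)

theorem hasStableOrbitsOn_of_isTopologizable (hw : ContinuousOn w X)
    (hw_dense : (X : Set (RSpace d)) ⊆ closure {x | x ∈ X ∧ w x ≠ 0})
    (hψ_open : ∀ U : Set (RSpace d), IsOpen U → U ⊆ X → IsOpen (ψ '' U))
    (hψ_maps : MapsTo ψ X X) (hψ : ContinuousOn ψ X)
    (hS : ∀ φ, ∀ x ∈ X, w x ≠ 0 → φ x ≠ 0 → S φ (ψ x) ≠ 0)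
    (hT : ∀ u φ, T u φ = u (S φ)) (htop : IsTopologizable T) :
    HasStableOrbitsOn (X : Set (RSpace d)) ψ := by
  have hψm (m : ℕ) : ContinuousOn ψ^[m] X := by
    induction m with
    | zero => exact continuousOn_id
    | succ m ih => rw [Function.iterate_succ]; exact ih.comp hψ hψ_maps
  have key (φ : 𝓓(X, ℂ)) : ∃ L : Set (RSpace d), IsCompact L ∧ L ⊆ X ∧
      ∀ m, ψ^[m] '' Function.support φ ⊆ L := by
    obtain ⟨L, hLc, hLX, hL⟩ := exists_compact_support_iterate_subset hT htop φ
    refine ⟨L, hLc, hLX, ?_⟩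
    rintro m _ ⟨x, hx, rfl⟩
    by_contra hxL
    have hφX : Function.support φ ⊆ X := (subset_tsupport φ).trans φ.tsupport_subset
    -- If `ψ^m x` were outside `L`, the same would hold on an open piece of `{φ ≠ 0}`, where `S^m φ
    -- ∘ ψ^m` would then vanish identically.
    have hU : IsOpen (Function.support φ ∩ ψ^[m] ⁻¹' Lᶜ) :=
      ((hψm m).mono hφX).isOpen_inter_preimage
        (isOpen_ne_fun φ.continuous continuous_const) hLc.isClosed.isOpen_compl
    obtain ⟨z, hz, hz'⟩ := exists_iterate_apply_ne_zero hw hw_dense hψ_open hψ_maps hS m φ _ hU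
      (inter_subset_left.trans hφX) ⟨x, hx, hxL⟩ fun z hz => hz.1
    exact hz.2 (hL m hz')
  intro K hK hKX
  -- The property passes to subsets and finite unions, so it suffices to have it near each point,
  -- where a bump function supplies the neighbourhood `{φ ≠ 0}`.
  refine hK.induction_on (p := fun K => ∃ L : Set (RSpace d), IsCompact L ∧ L ⊆ X ∧
    ∀ m, ψ^[m] '' K ⊆ L) ?_ ?_ ?_ ?_
  · exact ⟨∅, isCompact_empty, empty_subset _, fun m => by simp⟩
  · rintro s t hst ⟨L, hLc, hLX, hL⟩
    exact ⟨L, hLc, hLX, fun m => (image_mono hst).trans (hL m)⟩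
  · rintro s t ⟨L, hLc, hLX, hL⟩ ⟨L', hLc', hLX', hL'⟩
    refine ⟨L ∪ L', hLc.union hLc', union_subset hLX hLX', fun m => ?_⟩
    rw [image_union]
    exact union_subset_union (hL m) (hL' m)
  · intro x hx
    obtain ⟨f, hfX, hfc, hf, -, hfx⟩ :=
      exists_contDiff_tsupport_subset (n := ⊤) (X.isOpen.mem_nhds (hKX hx))
    have hsub : tsupport (fun y => (f y : ℂ)) ⊆ tsupport f :=
      tsupport_comp_subset Complex.ofReal_zero f
    let φ : 𝓓(X, ℂ) := ⟨fun y => (f y : ℂ), Complex.ofRealCLM.contDiff.comp hf,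
      hfc.comp_left Complex.ofReal_zero, hsub.trans hfX⟩
    refine ⟨Function.support φ, mem_nhdsWithin_of_mem_nhds ?_, key φ⟩
    refine (isOpen_ne_fun φ.continuous continuous_const).mem_nhds ?_
    change (f x : ℂ) ≠ 0
    simp [hfx]

end WeightedComposition

theorem mainTheorem2 (d : ℕ) (X : TopologicalSpace.Opens (RSpace d))
    (w : RSpace d → ℂ) (hw : ContDiffOn ℝ ∞ w X)
    (hw_dense : (X : Set (RSpace d)) ⊆ closure {x | x ∈ X ∧ w x ≠ 0})
    (ψ : RSpace d → RSpace d) (hψ_maps : Set.MapsTo ψ X X)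
    (hψ : ContDiffOn ℝ ∞ ψ X) (hψ_inj : Set.InjOn ψ X)
    (hψ_det : ∀ x ∈ X, (fderiv ℝ ψ x).det ≠ 0) :
    (∃! T : DistSpace X →L[ℂ] DistSpace X, IsWeightedCompositionOperator X w ψ T) ∧
    ∀ T : DistSpace X →L[ℂ] DistSpace X, IsWeightedCompositionOperator X w ψ T →
      (IsTopologizable T ↔ HasStableOrbitsOn (X : Set (RSpace d)) ψ) := by
  obtain ⟨S, hS_supp, hS_ne, hS⟩ :=
    exists_predual_weightedComposition hw hψ_maps hψ hψ_inj hψ_det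
  let T₀ : DistSpace X →L[ℂ] DistSpace X := ContinuousLinearMap.precomp ℂ S
  have hT₀ : IsWeightedCompositionOperator X w ψ T₀ := fun f hf => by
    ext φ
    exact hS f hf φ
  have huniq : ∀ T : DistSpace X →L[ℂ] DistSpace X, IsWeightedCompositionOperator X w ψ T →
      T = T₀ := fun T hT =>
    clm_ext_regularDist fun f hf => (hT f hf.continuousOn).trans (hT₀ f hf.continuousOn).symm
  refine ⟨⟨T₀, hT₀, huniq⟩, fun T hT => ?_⟩
  obtain rfl := huniq T hT
  have hdual : ∀ u φ, T₀ u φ = u (S φ) := fun _ _ => rfl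
  exact ⟨hasStableOrbitsOn_of_isTopologizable hw.continuousOn hw_dense
    (fun U hU hUX => isOpen_image_of_fderiv_det_ne_zero X.isOpen hψ hψ_det hU hUX) hψ_maps
    hψ.continuousOn hS_ne hdual, isTopologizable_of_hasStableOrbitsOn hS_supp hdual⟩
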